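/- Consider chord diagrams on finitely many (at least one) circles, not necessarily oriented, in which every chord endpoint carries a local orientation of the circle through it (for one oriented circle, the one induced by its orientation). For a chord $v$ of such a diagram $D$ let $D_v$ be the result of replacing $v$ by an untwisted band (surgery compatible with the local orientations at the endpoints of $v$), $D^v$ the result of replacing $v$ by a half-twisted band, and $D\setminus v$ the result of removing $v$; the other endpoints keep their local orientations. Let $O$ be a circle without chords. Let $R$ be a commutative ring and $a,b\in R$ (for instance $R=\mathbb{Z}[a,b]$ with $a,b$ indeterminates). The framed Kauffman weight system is the $R$-valued function $K$ on these diagrams with $$K(D)=a\bigl(K(D_v)-K(D^v)\bigr),\qquad K(D\cup O)=b\,K(D),\qquad K(O)=1,$$ and the unframed Kauffman weight system is the $R$-valued function $\widehat K$ with $$\widehat K(D)=a\widehat K(D_v)-a\widehat K(D^v)-a(b-1)\widehat K(D\setminus v),\qquad \widehat K(D\cup O)=b\,\widehat K(D),\qquad \widehat K(O)=1,$$ where the first relation is required for every chord $v$ of every diagram $D$. For a graph $G$ with $n$ vertices put $$\widehat S(G)(x)=\sum_{J\subseteq V(G)}\ \sum_{J_m\subseteq J}(-1)^{|J_m|}(x-1)^{n-|J|}x^{\operatorname{rank}(G_J^{J_m})}\in\mathbb{Z}[x],$$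 where $\operatorname{rank}(G_J^{J_m})$ is the rank over $\mathbb{Z}/2$ of the adjacency matrix of the subgraph induced by $J$, with the diagonal entries of the vertices in $J_m$ replaced by $1$. Theorem. Functions $K$ and $\widehat K$ with these properties exist. Let $D$ be a chord diagram of degree $k$ (one oriented circle with $k$ chords) with intersection graph $\Gamma(D)$. Then $\widehat K(D)$ is the value at $D$ of the canonical (deframing) projection of $K$, that is, $$\widehat K(D)=\sum_{J}(-1)^{k-|J|}\,K\bigl(\Theta^{k-|J|}\cdot D_J\bigr),$$ where $J$ runs over the sets of chords of $D$, $D_J$ is $D$ with only the chords in $J$ kept, $\Theta$ is the diagram with a single chord, and the product is the connected sum; and $$\widehat K(D)=(ab)^k\,\widehat S(\Gamma(D))(b^{-1})$$ in every commutative $R$-algebra in which $b$ is invertible (for instance in $\mathbb{Z}[a,b,b^{-1}]$ for $R=\mathbb{Z}[a,b]$). -/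

import Mathlib

open Polynomial

/-- One of the two sides of a point `p` on an oriented piece of curve: `(p, false)` is the incoming
side (just before `p`), `(p, true)` is the outgoing side (just after `p`). -/
abbrev Side : Type := ℕ × Bool

/-- A closed one-dimensional manifold with finitely many cuts, up to homeomorphism: the arcs between
the cuts are recorded by the involution `arc`, which sends every end of an arc to the other
end, and `circles` counts the components without cuts. -/
structure CurveSystem where
  sides : Finset Side
  arc : Side → Side
  circles : ℕ
  arc_mem : ∀ x ∈ sides, arc x ∈ sides
  arc_arc : ∀ x, arc (arc x) = x
  arc_ne : ∀ x ∈ sides, arc x ≠ x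
  arc_off : ∀ x, x ∉ sides → arc x = x

namespace CurveSystem

/-- Glue the two distinct ends `x` and `y`. If they are the two ends of one arc, this closes up
a circle; otherwise the two arcs become one arc. -/
def splice (C : CurveSystem) (x y : Side) (hx : x ∈ C.sides) (hy : y ∈ C.sides) (hxy : x ≠ y) :
    CurveSystem where
  sides := (C.sides.erase x).erase y
  arc := fun h =>
    if h = x ∨ h = y then h
    else if C.arc h = x then C.arc y
    else if C.arc h = y then C.arc x
    else C.arc h
  circles := C.circles + if C.arc x = y then 1 else 0
  arc_mem := by
    intro h hh
    have h1 := C.arc_mem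
    have h2 := C.arc_arc
    have h3 := C.arc_ne
    simp only [Finset.mem_erase] at hh ⊢
    grind
  arc_arc := by
    intro h
    have h2 := C.arc_arc
    have h3 := C.arc_ne
    grind
  arc_ne := by
    intro h hh
    have h2 := C.arc_arc
    have h3 := C.arc_ne
    simp only [Finset.mem_erase] at hh
    grind
  arc_off := by
    intro h hh
    have h2 := C.arc_arc
    have h4 := C.arc_off
    simp only [Finset.mem_erase] at hh
    grind

end CurveSystem

/-- A chord diagram on any number of circles: a finite set of chord endpoints (labelled by natural
numbers), the fixed-point-free involution `mate` that sends an endpoint to the other endpoint of its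
chord, and the circles on which they lie, cut at the endpoints. The circles as a whole need not be
oriented, but each endpoint carries a local orientation (its incoming and its outgoing side), which
it keeps when other chords are surgered. -/
structure MultiDiagram where
  pts : Finset ℕ
  mate : ℕ → ℕ
  mate_mem : ∀ p ∈ pts, mate p ∈ pts
  mate_mate : ∀ p, mate (mate p) = p
  mate_ne : ∀ p ∈ pts, mate p ≠ p
  mate_off : ∀ p, p ∉ pts → mate p = p
  curve : CurveSystem
  sides_eq : curve.sides = pts ×ˢ (Finset.univ : Finset Bool)

/-- The three things that can be done with a chord: replace it by an untwisted band,
replace it by a half-twisted band, or remove it. -/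
inductive Resolution where
  | untwisted
  | twisted
  | removed

namespace Resolution

/-- The side glued to the outgoing side of `p`, for a chord with endpoints `p` and `q`. -/
def partner : Resolution → ℕ → ℕ → Side
  | untwisted, _, q => (q, false)
  | twisted, _, q => (q, true)
  | removed, p, _ => (p, false)

/-- The first of the two remaining sides. -/
def rest₁ : Resolution → ℕ → ℕ → Side
  | untwisted, _, q => (q, true)
  | twisted, _, q => (q, false)
  | removed, _, q => (q, true)

/-- The second of the two remaining sides. -/
def rest₂ : Resolution → ℕ → ℕ → Side
  | untwisted, p, _ => (p, false)
  | twisted, p, _ => (p, false)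
  | removed, _, q => (q, false)

end Resolution

namespace MultiDiagram

theorem mem_sides (D : MultiDiagram) {p : ℕ} (hp : p ∈ D.pts) (s : Bool) :
    (p, s) ∈ D.curve.sides := by
  rw [D.sides_eq]; simp [hp]

/-- Resolve the chord with endpoints `p` and `q = mate p`. In an untwisted band surgery the incoming
side of each endpoint is glued to the outgoing side of the other one; in a half-twisted band
surgery the two outgoing sides are glued together and the two incoming sides are glued together; when
the chord is removed, the two sides of each endpoint are glued together. -/
def resolve (D : MultiDiagram) (r : Resolution) (p : ℕ) (hp : p ∈ D.pts) : MultiDiagram where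
  pts := (D.pts.erase p).erase (D.mate p)
  mate := fun x => if x = p ∨ x = D.mate p then x else D.mate x
  mate_mem := by
    intro x hx
    have h1 := D.mate_mem
    have h2 := D.mate_mate
    simp only [Finset.mem_erase] at hx ⊢
    grind
  mate_mate := by
    intro x
    have h2 := D.mate_mate
    grind
  mate_ne := by
    intro x hx
    have h3 := D.mate_ne
    simp only [Finset.mem_erase] at hx
    grind
  mate_off := by
    intro x hx
    have h4 := D.mate_off
    simp only [Finset.mem_erase] at hx
    grind
  curve :=
    (D.curve.splice (p, true) (r.partner p (D.mate p)) (D.mem_sides hp true)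
      (by
        have := D.mem_sides hp
        have := D.mem_sides (D.mate_mem p hp)
        cases r <;> simp [Resolution.partner, *])
      (by
        have := D.mate_ne p hp
        cases r <;> simp [Resolution.partner, this.symm])).splice
      (r.rest₁ p (D.mate p)) (r.rest₂ p (D.mate p))
      (by
        have := D.mem_sides hp
        have := D.mem_sides (D.mate_mem p hp)
        have := D.mate_ne p hp
        cases r <;> simp [CurveSystem.splice, Resolution.partner, Resolution.rest₁, *])
      (by
        have := D.mem_sides hp
        have := D.mem_sides (D.mate_mem p hp)
        have := D.mate_ne p hp
        have := this.symm
        cases r <;> simp [CurveSystem.splice, Resolution.partner, Resolution.rest₂, *])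
      (by
        have := D.mate_ne p hp
        cases r <;> simp [Resolution.rest₁, Resolution.rest₂, this])
  sides_eq := by
    have h := D.sides_eq
    ext ⟨x, s⟩
    cases r <;> cases s <;>
      simp [CurveSystem.splice, Resolution.partner, Resolution.rest₁, Resolution.rest₂, h] <;> grind

/-- The diagram has at least one circle. -/
def IsNonempty (D : MultiDiagram) : Prop := D.pts.Nonempty ∨ 0 < D.curve.circles

/-- Disjoint union with a circle that carries no chord endpoints. -/
def addCircle (D : MultiDiagram) : MultiDiagram :=
  { D with curve := { D.curve with circles := D.curve.circles + 1 } }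

/-- A single circle without chords. -/
def circle : MultiDiagram where
  pts := ∅
  mate := fun p => p
  mate_mem := by simp
  mate_mate := by simp
  mate_ne := by simp
  mate_off := by simp
  curve :=
    { sides := ∅
      arc := fun x => x
      circles := 1
      arc_mem := by simp
      arc_arc := by simp
      arc_ne := by simp
      arc_off := by simp }
  sides_eq := by simp

end MultiDiagram

/-- The relations that define the framed Kauffman weight system. -/
structure IsFramedKauffman {R : Type*} [CommRing R] (a b : R) (K : MultiDiagram → R) : Prop where
  skein : ∀ (D : MultiDiagram) (p : ℕ) (hp : p ∈ D.pts),
    K D = a * (K (D.resolve .untwisted p hp) - K (D.resolve .twisted p hp))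
  addCircle : ∀ D : MultiDiagram, D.IsNonempty → K D.addCircle = b * K D
  circle : K MultiDiagram.circle = 1

/-- The relations that define the unframed Kauffman weight system. -/
structure IsUnframedKauffman {R : Type*} [CommRing R] (a b : R) (K : MultiDiagram → R) :
    Prop where
  skein : ∀ (D : MultiDiagram) (p : ℕ) (hp : p ∈ D.pts),
    K D = a * K (D.resolve .untwisted p hp) - a * K (D.resolve .twisted p hp)
      - a * (b - 1) * K (D.resolve .removed p hp)
  addCircle : ∀ D : MultiDiagram, D.IsNonempty → K D.addCircle = b * K D
  circle : K MultiDiagram.circle = 1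

/-- A chord diagram on one oriented circle: the endpoints are labelled by natural numbers, in their
cyclic order along the circle, starting from some base point. -/
structure ChordDiagram where
  pts : Finset ℕ
  mate : ℕ → ℕ
  mate_mem : ∀ p ∈ pts, mate p ∈ pts
  mate_mate : ∀ p, mate (mate p) = p
  mate_ne : ∀ p ∈ pts, mate p ≠ p
  mate_off : ∀ p, p ∉ pts → mate p = p

/-- The element of `s` that follows `p` in the cyclic order. -/
def cyclicNext (s : Finset ℕ) (p : ℕ) : ℕ :=
  if h : (s.filter (fun q => p < q)).Nonempty then (s.filter (fun q => p < q)).min' h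
  else if h : s.Nonempty then s.min' h else p

/-- The element of `s` that precedes `p` in the cyclic order. -/
def cyclicPrev (s : Finset ℕ) (p : ℕ) : ℕ :=
  if h : (s.filter (fun q => q < p)).Nonempty then (s.filter (fun q => q < p)).max' h
  else if h : s.Nonempty then s.max' h else p

theorem cyclicNext_mem (s : Finset ℕ) (p : ℕ) (hp : p ∈ s) : cyclicNext s p ∈ s := by
  unfold cyclicNext
  split_ifs with h1 h2
  · exact (Finset.mem_filter.1 (Finset.min'_mem _ h1)).1
  · exact Finset.min'_mem _ _
  · exact hp

theorem cyclicPrev_mem (s : Finset ℕ) (p : ℕ) (hp : p ∈ s) : cyclicPrev s p ∈ s := by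
  unfold cyclicPrev
  split_ifs with h1 h2
  · exact (Finset.mem_filter.1 (Finset.max'_mem _ h1)).1
  · exact Finset.max'_mem _ _
  · exact hp

theorem cyclicNext_spec (s : Finset ℕ) (p : ℕ) (hp : p ∈ s) :
    (p < cyclicNext s p ∧ ∀ q ∈ s, p < q → cyclicNext s p ≤ q) ∨
      ((∀ q ∈ s, q ≤ p) ∧ ∀ q ∈ s, cyclicNext s p ≤ q) := by
  unfold cyclicNext
  split_ifs with h1 h2
  · left
    exact ⟨(Finset.mem_filter.1 (Finset.min'_mem _ h1)).2,
      fun q hq hpq => Finset.min'_le _ _ (Finset.mem_filter.2 ⟨hq, hpq⟩)⟩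
  · right
    refine ⟨fun q hq => ?_, fun q hq => Finset.min'_le _ _ hq⟩
    by_contra hlt
    exact h1 ⟨q, Finset.mem_filter.2 ⟨hq, not_le.1 hlt⟩⟩
  · exact absurd ⟨p, hp⟩ h2

theorem cyclicPrev_spec (s : Finset ℕ) (p : ℕ) (hp : p ∈ s) :
    (cyclicPrev s p < p ∧ ∀ q ∈ s, q < p → q ≤ cyclicPrev s p) ∨
      ((∀ q ∈ s, p ≤ q) ∧ ∀ q ∈ s, q ≤ cyclicPrev s p) := by
  unfold cyclicPrev
  split_ifs with h1 h2
  · left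
    exact ⟨(Finset.mem_filter.1 (Finset.max'_mem _ h1)).2,
      fun q hq hpq => Finset.le_max' _ _ (Finset.mem_filter.2 ⟨hq, hpq⟩)⟩
  · right
    refine ⟨fun q hq => ?_, fun q hq => Finset.le_max' _ _ hq⟩
    by_contra hlt
    exact h1 ⟨q, Finset.mem_filter.2 ⟨hq, not_le.1 hlt⟩⟩
  · exact absurd ⟨p, hp⟩ h2

theorem cyclicPrev_next (s : Finset ℕ) (p : ℕ) (hp : p ∈ s) :
    cyclicPrev s (cyclicNext s p) = p := by
  have h1 := cyclicNext_mem s p hp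
  have h2 := cyclicPrev_mem s _ h1
  have h3 := cyclicNext_spec s p hp
  have h4 := cyclicPrev_spec s _ h1
  grind

theorem cyclicNext_prev (s : Finset ℕ) (p : ℕ) (hp : p ∈ s) :
    cyclicNext s (cyclicPrev s p) = p := by
  have h1 := cyclicPrev_mem s p hp
  have h2 := cyclicNext_mem s _ h1
  have h3 := cyclicPrev_spec s p hp
  have h4 := cyclicNext_spec s _ h1
  grind

namespace ChordDiagram

/-- A chord is named by its smaller endpoint. -/
def chords (D : ChordDiagram) : Finset ℕ := D.pts.filter (fun p => p < D.mate p)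

/-- The degree: the number of chords. -/
def degree (D : ChordDiagram) : ℕ := D.chords.card

/-- The chord diagram as a diagram on one circle, oriented along the cyclic order. -/
def toMulti (D : ChordDiagram) : MultiDiagram where
  pts := D.pts
  mate := D.mate
  mate_mem := D.mate_mem
  mate_mate := D.mate_mate
  mate_ne := D.mate_ne
  mate_off := D.mate_off
  curve :=
    { sides := D.pts ×ˢ Finset.univ
      arc := fun x =>
        if x.1 ∈ D.pts then
          if x.2 = true then (cyclicNext D.pts x.1, false) else (cyclicPrev D.pts x.1, true)
        else x
      circles := if D.pts = ∅ then 1 else 0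
      arc_mem := by
        rintro ⟨p, s⟩ h
        have h1 := cyclicNext_mem D.pts p
        have h2 := cyclicPrev_mem D.pts p
        simp only [Finset.mem_product, Finset.mem_univ, and_true] at h ⊢
        cases s <;> simp_all
      arc_arc := by
        rintro ⟨p, s⟩
        have h1 := cyclicNext_mem D.pts p
        have h2 := cyclicPrev_mem D.pts p
        have h3 := cyclicPrev_next D.pts p
        have h4 := cyclicNext_prev D.pts p
        by_cases hp : p ∈ D.pts <;> cases s <;> simp_all
      arc_ne := by
        rintro ⟨p, s⟩ h
        simp only [Finset.mem_product, Finset.mem_univ, and_true] at h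
        cases s <;> simp_all
      arc_off := by
        rintro ⟨p, s⟩ h
        simp_all }
  sides_eq := rfl

/-- The diagram that keeps exactly the chords in `J`. -/
def keep (D : ChordDiagram) (J : Finset ℕ) : ChordDiagram where
  pts := D.pts.filter (fun p => p ∈ J ∨ D.mate p ∈ J)
  mate := fun p => if p ∈ J ∨ D.mate p ∈ J then D.mate p else p
  mate_mem := by
    intro p hp
    have h1 := D.mate_mem
    have h2 := D.mate_mate
    simp only [Finset.mem_filter] at hp ⊢
    grind
  mate_mate := by
    intro p
    have h2 := D.mate_mate
    grind
  mate_ne := by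
    intro p hp
    have h3 := D.mate_ne
    simp only [Finset.mem_filter] at hp
    grind
  mate_off := by
    intro p hp
    have h4 := D.mate_off
    simp only [Finset.mem_filter] at hp
    grind

/-- A natural number that exceeds all endpoints. -/
def fresh (D : ChordDiagram) : ℕ := D.pts.sup id + 1

theorem lt_fresh (D : ChordDiagram) (p : ℕ) (hp : p ∈ D.pts) : p < D.fresh :=
  Nat.lt_succ_of_le (Finset.le_sup (f := id) hp)

/-- The connected sum with the diagram `Θ` that has a single chord: two new adjacent endpoints,
joined by a chord, are inserted at the base point. -/
def addTheta (D : ChordDiagram) : ChordDiagram where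
  pts := insert D.fresh (insert (D.fresh + 1) D.pts)
  mate := fun p =>
    if p = D.fresh then D.fresh + 1 else if p = D.fresh + 1 then D.fresh else D.mate p
  mate_mem := by
    intro p hp
    have h1 := D.mate_mem
    simp only [Finset.mem_insert] at hp ⊢
    grind
  mate_mate := by
    intro p
    have h0 := D.lt_fresh
    have h1 := D.mate_mem
    have h2 := D.mate_mate
    have h4 := D.mate_off
    grind
  mate_ne := by
    intro p hp
    have h3 := D.mate_ne
    simp only [Finset.mem_insert] at hp
    grind
  mate_off := by
    intro p hp
    have h4 := D.mate_off
    simp only [Finset.mem_insert] at hp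
    grind

/-- The canonical (deframing) projection of a function `W` on chord diagrams: the linear extension
of `W` is evaluated at `φ (Δ D)`, where `Δ D` is the sum over all sets `J` of chords of
`D' ⊗ D''` (`D'` is `D` with `J` removed, `D''` is `D` with only `J` kept) and
`φ (D' ⊗ D'') = (-Θ) ^ (deg D') · D''`. -/
def deframe {R : Type*} [CommRing R] (W : ChordDiagram → R) (D : ChordDiagram) : R :=
  ∑ J ∈ D.chords.powerset,
    (-1) ^ (D.keep (D.chords \ J)).degree *
      W (addTheta^[(D.keep (D.chords \ J)).degree] (D.keep J))

/-- The intersection graph: two chords are adjacent when their endpoints alternate. -/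
def intersectionGraph (D : ChordDiagram) : SimpleGraph {p : ℕ // p ∈ D.chords} where
  Adj p q :=
    (p.1 < q.1 ∧ q.1 < D.mate p.1 ∧ D.mate p.1 < D.mate q.1) ∨
      (q.1 < p.1 ∧ p.1 < D.mate q.1 ∧ D.mate q.1 < D.mate p.1)
  symm := ⟨fun _ _ h => h.symm⟩
  loopless := ⟨fun _ h => by
    rcases h with h | h <;> exact absurd h.1 (lt_irrefl _)⟩

end ChordDiagram

open Classical in
/-- The adjacency matrix over `ℤ/2` of the graph `G` with the vertices in `J` marked: a marked
vertex has a `1` on the diagonal. -/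
noncomputable def markedAdj {V : Type*} [Fintype V] (G : SimpleGraph V) (J : Finset V) :
    Matrix V V (ZMod 2) :=
  Matrix.of fun i j => if i = j then (if i ∈ J then 1 else 0) else (if G.Adj i j then 1 else 0)

/-- `S(G)(x)`, the sum over all markings `J` of `(-1)^|J| x^(rank G^J)`. -/
noncomputable def graphS {V : Type*} [Fintype V] (G : SimpleGraph V) : ℤ[X] :=
  ∑ J : Finset V, (-1) ^ J.card * X ^ (markedAdj G J).rank

/-- `Ŝ(G)(x)`, the sum over all sets `J` of vertices of `(x - 1)^(n - |J|) S(G_J)(x)`, where `G_J`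
is the subgraph induced by `J`. -/
noncomputable def graphSHat {V : Type*} [Fintype V] (G : SimpleGraph V) : ℤ[X] :=
  ∑ J : Finset V, (X - 1) ^ (Fintype.card V - J.card) * graphS (G.induce {v | v ∈ J})

/-!
The circles of a fully resolved diagram are counted by colourings: a closed one-dimensional manifold
with `c` circles has `2 ^ c` locally constant functions to `ℤ/2`. For a diagram `D` and a state `s`
(a resolution for each chord) these functions are the functions on the sides of the endpoints that
are constant along the arcs and satisfy the gluing equations of `s`, together with a free value
on every circle without endpoints. Gluing two ends does not change the number of colourings
(`CurveSystem.numColorings_splice`), so the number of circles `circleCount D s` is not changed when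
a single chord is resolved according to `s` (`MultiDiagram.circleCount_resolve`).

*Existence and uniqueness.* The relations force the state sum
`∑ J, ∑ M ⊆ J, e ^ (k - |J|) * a ^ |J| * (-1) ^ |M| * b ^ (circles - 1)`, where the chords outside `J`
are removed, those in `M` become half-twisted bands and those in `J \ M` untwisted bands, with `e = 0`
in the framed and `e = -a(b - 1)` in the unframed case (`MultiDiagram.eq_stateSum`). Conversely,
this sum satisfies the relations: splitting it according to the state of one chord is the skein
relation (`MultiDiagram.stateSum_skein`).

*Circles and coranks.* On one oriented circle a colouring is determined by its value at a base point
and its jumps at the endpoints. The gluing equations say that the two endpoints of a chord have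
the same jump `x v`, that the jump is zero at removed chords, and that the jumps strictly between the
endpoints of an untwisted band `v` sum to zero, while for a half-twisted band they sum to `x v`.
In the sum between the endpoints of `v` exactly the chords interlaced with `v` survive modulo 2, so the
last two conditions say that `x` is in the kernel of the marked adjacency matrix of the intersection
graph. Hence there are `2 * 2 ^ (|J| - rank)` colourings (`ChordDiagram.numColorings_state`,
`kernelCard_eq_two_pow`), and the state sum becomes `Ŝ` (`aeval_graphSHat`).

*Deframing.* An isolated chord doubles the kernel if it is unmarked and leaves it unchanged if it is
marked, so a connected sum with `Θ` multiplies the framed state sum by `a(b - 1)`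
(`ChordDiagram.stateSum_addTheta`). Therefore `(-Θ) ^ (k - |J|)` contributes `e ^ (k - |J|)` with
`e = -a(b - 1)`, and the deframing of the framed state sum is the unframed one.
-/

/-! ### Colourings of curve systems -/

namespace CurveSystem

/-- A colouring of the ends of the arcs by `ℤ/2` that is constant along every arc. It is extended by
zero to all of `Side`, so that different curve systems can be compared. -/
def IsColoring (C : CurveSystem) (f : Side → ZMod 2) : Prop :=
  (∀ x, x ∉ C.sides → f x = 0) ∧ ∀ x, f (C.arc x) = f x

/-- The number of locally constant functions to `ℤ/2` on the curve system whose restriction to the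
ends of the arcs satisfies `P`; each circle without cuts contributes a factor `2`. -/
noncomputable def numColorings (C : CurveSystem) (P : (Side → ZMod 2) → Prop) : ℕ :=
  2 ^ C.circles * Nat.card {f : Side → ZMod 2 // C.IsColoring f ∧ P f}

instance (C : CurveSystem) (P : (Side → ZMod 2) → Prop) :
    Finite {f : Side → ZMod 2 // C.IsColoring f ∧ P f} := by
  refine Finite.of_injective (β := C.sides → ZMod 2) (fun f x => f.1 x) ?_
  rintro ⟨f, hf, hPf⟩ ⟨g, hg, hPg⟩ h
  refine Subtype.ext (funext fun x => ?_)
  by_cases hx : x ∈ C.sides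
  · exact congrFun h ⟨x, hx⟩
  · exact (hf.1 x hx).trans (hg.1 x hx).symm

theorem numColorings_congr (C : CurveSystem) {P Q : (Side → ZMod 2) → Prop}
    (h : ∀ f, P f ↔ Q f) : C.numColorings P = C.numColorings Q := by
  rw [funext fun f => propext (h f)]

/-- Gluing `x` to `y` does not change the number of colourings that agree at `x` and `y`. If `x` and `y`
are the ends of one arc, its free value becomes the free value of the new circle; otherwise the values
at `x` and `y` can be recovered from the other ends of their arcs. -/
theorem numColorings_splice (C : CurveSystem) (x y : Side) (hx : x ∈ C.sides) (hy : y ∈ C.sides)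
    (hxy : x ≠ y) (P : (Side → ZMod 2) → Prop)
    (hP : ∀ f g : Side → ZMod 2, (∀ z, z ≠ x → z ≠ y → f z = g z) → P f → P g) :
    C.numColorings (fun f => f x = f y ∧ P f) = (C.splice x y hx hy hxy).numColorings P := by
  have h1 := C.arc_mem
  have h2 := C.arc_arc
  have h3 := C.arc_ne
  have h4 := C.arc_off
  by_cases hc : C.arc x = y
  -- The glued arc closes up to a circle, and its common value becomes free.
  · have e : {f : Side → ZMod 2 // C.IsColoring f ∧ f x = f y ∧ P f} ≃
        ZMod 2 × {f : Side → ZMod 2 // (C.splice x y hx hy hxy).IsColoring f ∧ P f} :=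
      { toFun := fun f => (f.1 x, ⟨fun z => if z = x ∨ z = y then 0 else f.1 z, by
          obtain ⟨f, ⟨hf0, hf1⟩, hf2, hf3⟩ := f
          refine ⟨⟨fun z hz => ?_, fun z => ?_⟩, hP f _ (by grind) hf3⟩
          · simp only [splice, Finset.mem_erase] at hz
            grind
          · simp only [splice]
            grind⟩)
        invFun := fun q => ⟨fun z => if z = x ∨ z = y then q.1 else q.2.1 z, by
          obtain ⟨c, f, ⟨hf0, hf1⟩, hf3⟩ := q
          refine ⟨⟨fun z hz => ?_, fun z => ?_⟩, by simp, hP f _ (by grind) hf3⟩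
          · simp only [splice, Finset.mem_erase] at hf0
            grind
          · have := hf1 z
            simp only [splice] at this
            grind⟩
        left_inv := by
          rintro ⟨f, ⟨hf0, hf1⟩, hf2, hf3⟩
          refine Subtype.ext (funext fun z => ?_)
          simp only
          grind
        right_inv := by
          rintro ⟨c, f, ⟨hf0, hf1⟩, hf3⟩
          refine Prod.ext (by simp) (Subtype.ext (funext fun z => ?_))
          simp only [splice, Finset.mem_erase] at hf0 ⊢
          grind }
    simp only [numColorings]
    rw [Nat.card_congr e, Nat.card_prod, Nat.card_zmod]
    simp only [splice, hc, if_true, pow_succ]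
    ring
  · have e : {f : Side → ZMod 2 // C.IsColoring f ∧ f x = f y ∧ P f} ≃
        {f : Side → ZMod 2 // (C.splice x y hx hy hxy).IsColoring f ∧ P f} :=
      { toFun := fun f => ⟨fun z => if z = x ∨ z = y then 0 else f.1 z, by
          obtain ⟨f, ⟨hf0, hf1⟩, hf2, hf3⟩ := f
          refine ⟨⟨fun z hz => ?_, fun z => ?_⟩, hP f _ (by grind) hf3⟩
          · simp only [splice, Finset.mem_erase] at hz
            grind
          · simp only [splice]
            grind⟩
        invFun := fun q => ⟨fun z => if z = x ∨ z = y then q.1 (C.arc x) else q.1 z, by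
          obtain ⟨f, ⟨hf0, hf1⟩, hf3⟩ := q
          refine ⟨⟨fun z hz => ?_, fun z => ?_⟩, by simp, hP f _ (by grind) hf3⟩
          · simp only [splice, Finset.mem_erase] at hf0
            grind
          · have h5 := hf1 z
            have h6 := hf1 (C.arc x)
            simp only [splice] at h5 h6
            grind⟩
        left_inv := by
          rintro ⟨f, ⟨hf0, hf1⟩, hf2, hf3⟩
          refine Subtype.ext (funext fun z => ?_)
          simp only
          grind
        right_inv := by
          rintro ⟨f, ⟨hf0, hf1⟩, hf3⟩
          refine Subtype.ext (funext fun z => ?_)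
          simp only [splice, Finset.mem_erase] at hf0 ⊢
          grind }
    simp only [numColorings]
    rw [Nat.card_congr e]
    simp [splice, hc]

end CurveSystem

/-! ### Counting the circles of a state -/

namespace MultiDiagram

/-- A chord is named by its smaller endpoint. -/
def chords (D : MultiDiagram) : Finset ℕ := D.pts.filter (fun p => p < D.mate p)

/-- The gluing equations of the state `s`: `f` agrees on any two sides that are glued when each
chord `v` is resolved by `s v`. -/
def Compatible (D : MultiDiagram) (s : ℕ → Resolution) (f : Side → ZMod 2) : Prop :=
  ∀ v ∈ D.chords, f (v, true) = f ((s v).partner v (D.mate v)) ∧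
    f ((s v).rest₁ v (D.mate v)) = f ((s v).rest₂ v (D.mate v))

/-- The number of circles after all chords are resolved according to `s`, computed as the binary
logarithm of the number of colourings. Only the values of `s` on the names of chords matter. -/
noncomputable def circleCount (D : MultiDiagram) (s : ℕ → Resolution) : ℕ :=
  Nat.log 2 (D.curve.numColorings (D.Compatible s))

theorem circleCount_congr (D : MultiDiagram) {s t : ℕ → Resolution}
    (h : ∀ v ∈ D.chords, s v = t v) : D.circleCount s = D.circleCount t := by
  unfold circleCount
  rw [D.curve.numColorings_congr (Q := D.Compatible t)]
  intro f
  exact forall₂_congr fun v hv => by rw [h v hv]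

theorem chords_resolve (D : MultiDiagram) (r : Resolution) (p : ℕ) (hp : p ∈ D.pts) :
    (D.resolve r p hp).chords = D.chords.erase (min p (D.mate p)) := by
  have h2 := D.mate_mate
  have h3 := D.mate_ne
  ext x
  simp only [chords, resolve, Finset.mem_filter, Finset.mem_erase]
  grind

theorem min_mem_chords (D : MultiDiagram) (p : ℕ) (hp : p ∈ D.pts) :
    min p (D.mate p) ∈ D.chords := by
  have h1 := D.mate_mem
  have h2 := D.mate_mate
  have h3 := D.mate_ne
  simp only [chords, Finset.mem_filter]
  grind

/-- The gluing equations split into those of the chord through `p` and those of the resolved diagram.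
The former are symmetric in the two endpoints, so `p` may be either of them. -/
theorem compatible_iff_resolve (D : MultiDiagram) (s : ℕ → Resolution) (p : ℕ) (hp : p ∈ D.pts)
    (r : Resolution) (hr : s (min p (D.mate p)) = r) (f : Side → ZMod 2) :
    D.Compatible s f ↔ f (p, true) = f (r.partner p (D.mate p)) ∧
      f (r.rest₁ p (D.mate p)) = f (r.rest₂ p (D.mate p)) ∧ (D.resolve r p hp).Compatible s f := by
  have h2 := D.mate_mate
  have key : (f (min p (D.mate p), true) =
        f (r.partner (min p (D.mate p)) (D.mate (min p (D.mate p)))) ∧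
      f (r.rest₁ (min p (D.mate p)) (D.mate (min p (D.mate p)))) =
        f (r.rest₂ (min p (D.mate p)) (D.mate (min p (D.mate p))))) ↔
      f (p, true) = f (r.partner p (D.mate p)) ∧
      f (r.rest₁ p (D.mate p)) = f (r.rest₂ p (D.mate p)) := by
    rcases min_choice p (D.mate p) with h | h
    · rw [h]
    · rw [h, h2]
      cases r <;> simp only [Resolution.partner, Resolution.rest₁, Resolution.rest₂] <;> grind
  rw [← and_assoc, ← key]
  unfold Compatible
  rw [chords_resolve]
  have hm : ∀ v ∈ D.chords.erase (min p (D.mate p)), (D.resolve r p hp).mate v = D.mate v := by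
    intro v hv
    have h3 := D.mate_mate v
    simp only [resolve, Finset.mem_erase, chords, Finset.mem_filter] at hv ⊢
    grind
  constructor
  · intro h
    refine ⟨?_, fun v hv => ?_⟩
    · have := h _ (D.min_mem_chords p hp)
      rwa [hr] at this
    · rw [hm v hv]
      exact h v (Finset.mem_of_mem_erase hv)
  · rintro ⟨h, h'⟩ v hv
    by_cases hvp : v = min p (D.mate p)
    · rw [hvp, hr]
      exact h
    · have := h' v (Finset.mem_erase.2 ⟨hvp, hv⟩)
      rwa [hm v (Finset.mem_erase.2 ⟨hvp, hv⟩)] at this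

/-- The gluing equations of the resolved diagram do not involve the sides of the endpoints of the
resolved chord. -/
theorem compatible_resolve_congr (D : MultiDiagram) (s : ℕ → Resolution) (p : ℕ) (hp : p ∈ D.pts)
    (r : Resolution) (f g : Side → ZMod 2)
    (hfg : ∀ z : Side, z.1 ≠ p → z.1 ≠ D.mate p → f z = g z)
    (h : (D.resolve r p hp).Compatible s f) : (D.resolve r p hp).Compatible s g := by
  intro v hv
  have h0 := h v hv
  have h2 := D.mate_mate
  have hv' : v ≠ p ∧ v ≠ D.mate p := by
    simp only [chords, resolve] at hv
    grind
  have hw : (D.resolve r p hp).mate v ≠ p ∧ (D.resolve r p hp).mate v ≠ D.mate p := by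
    simp only [resolve]
    grind
  have f1 : ∀ i, f (v, i) = g (v, i) := fun i => hfg _ hv'.1 hv'.2
  have f2 : ∀ i, f ((D.resolve r p hp).mate v, i) = g ((D.resolve r p hp).mate v, i) :=
    fun i => hfg _ hw.1 hw.2
  revert h0
  cases s v <;> simp only [Resolution.partner, Resolution.rest₁, Resolution.rest₂, f1, f2] <;>
    exact id

theorem numColorings_resolve (D : MultiDiagram) (s : ℕ → Resolution) (p : ℕ) (hp : p ∈ D.pts)
    (r : Resolution) (hr : s (min p (D.mate p)) = r) :
    D.curve.numColorings (D.Compatible s) =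
      (D.resolve r p hp).curve.numColorings ((D.resolve r p hp).Compatible s) := by
  rw [D.curve.numColorings_congr (D.compatible_iff_resolve s p hp r hr)]
  have hne := D.mate_ne p hp
  rw [CurveSystem.numColorings_splice]
  · unfold resolve
    dsimp only
    refine CurveSystem.numColorings_splice _ _ _ _ _ _ _ ?_
    intro f g hfg
    refine compatible_resolve_congr D s p hp r f g fun z h1 h2 => ?_
    apply hfg <;> rintro rfl <;> cases r <;> simp_all [Resolution.rest₁, Resolution.rest₂]
  · rintro f g hfg ⟨h1, h2⟩
    refine ⟨?_, ?_⟩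
    · rw [← hfg, ← hfg]
      · exact h1
      all_goals
        cases r <;> simp [Resolution.partner, Resolution.rest₁, Resolution.rest₂, hne, hne.symm]
    · refine compatible_resolve_congr D s p hp r f g (fun z h3 h4 => ?_) h2
      apply hfg <;> rintro rfl <;> cases r <;> simp_all [Resolution.partner]

theorem circleCount_resolve (D : MultiDiagram) (s : ℕ → Resolution) (p : ℕ) (hp : p ∈ D.pts)
    (r : Resolution) (hr : s (min p (D.mate p)) = r) :
    D.circleCount s = (D.resolve r p hp).circleCount s := by
  rw [circleCount, D.numColorings_resolve s p hp r hr, circleCount]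

theorem compatible_zero (D : MultiDiagram) (s : ℕ → Resolution) : D.Compatible s 0 :=
  fun _ _ => ⟨rfl, rfl⟩

theorem compatible_indicator (D : MultiDiagram) (s : ℕ → Resolution) :
    D.Compatible s (fun x => if x.1 ∈ D.pts then 1 else 0) := by
  intro v hv
  have h1 : v ∈ D.pts := (Finset.mem_filter.1 hv).1
  have h2 := D.mate_mem v h1
  cases s v <;> simp [Resolution.partner, Resolution.rest₁, Resolution.rest₂, h1, h2]

theorem mem_sides_iff (D : MultiDiagram) (x : Side) : x ∈ D.curve.sides ↔ x.1 ∈ D.pts := by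
  rw [D.sides_eq]; simp

/-- The zero colouring differs from the one that is constantly one, or there is a circle without
endpoints. -/
theorem two_le_numColorings (D : MultiDiagram) (s : ℕ → Resolution) (h : D.IsNonempty) :
    2 ≤ D.curve.numColorings (D.Compatible s) := by
  have z : D.curve.IsColoring 0 ∧ D.Compatible s 0 :=
    ⟨⟨fun _ _ => rfl, fun _ => rfl⟩, D.compatible_zero s⟩
  unfold CurveSystem.numColorings
  rcases h with ⟨p, hp⟩ | h
  · have o : D.curve.IsColoring (fun x => if x.1 ∈ D.pts then 1 else 0) := by
      have h1 := D.curve.arc_mem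
      have h2 := D.curve.arc_arc
      simp only [← D.mem_sides_iff]
      constructor <;> grind
    have : Nontrivial {f : Side → ZMod 2 // D.curve.IsColoring f ∧ D.Compatible s f} :=
      ⟨⟨0, z⟩, ⟨_, o, D.compatible_indicator s⟩, fun h => by
        have := congrFun (congrArg Subtype.val h) (p, true)
        simp [hp] at this⟩
    have h1 := Finite.one_lt_card (α := {f : Side → ZMod 2 // D.curve.IsColoring f ∧ D.Compatible s f})
    have h2 : 1 ≤ 2 ^ D.curve.circles := Nat.one_le_two_pow
    nlinarith
  · have : Nonempty {f : Side → ZMod 2 // D.curve.IsColoring f ∧ D.Compatible s f} := ⟨⟨0, z⟩⟩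
    have h1 := Finite.card_pos (α := {f : Side → ZMod 2 // D.curve.IsColoring f ∧ D.Compatible s f})
    have h2 : 2 ^ 1 ≤ 2 ^ D.curve.circles := Nat.pow_le_pow_right (by norm_num) h
    nlinarith

theorem circleCount_pos (D : MultiDiagram) (s : ℕ → Resolution) (h : D.IsNonempty) :
    0 < D.circleCount s :=
  Nat.log_pos (by norm_num) (D.two_le_numColorings s h)

theorem chords_eq_empty (D : MultiDiagram) (h : D.pts = ∅) : D.chords = ∅ := by
  simp [chords, h]

theorem circleCount_of_pts_eq_empty (D : MultiDiagram) (s : ℕ → Resolution) (h : D.pts = ∅) :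
    D.circleCount s = D.curve.circles := by
  have : Unique {f : Side → ZMod 2 // D.curve.IsColoring f ∧ D.Compatible s f} :=
    { default := ⟨0, ⟨fun _ _ => rfl, fun _ => rfl⟩, D.compatible_zero s⟩
      uniq := by
        rintro ⟨f, ⟨hf, -⟩, -⟩
        refine Subtype.ext (funext fun x => hf x ?_)
        simp [D.mem_sides_iff, h] }
  rw [circleCount, CurveSystem.numColorings, Nat.card_unique, mul_one,
    Nat.log_pow (by norm_num)]

theorem isNonempty_resolve (D : MultiDiagram) (r : Resolution) (p : ℕ) (hp : p ∈ D.pts) :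
    (D.resolve r p hp).IsNonempty := by
  by_cases h : (D.resolve r p hp).pts = ∅
  · right
    -- No endpoints are left, so the number of circles is that of a state of `D`.
    rw [← circleCount_of_pts_eq_empty _ (fun _ => r) h, ← circleCount_resolve D _ p hp r rfl]
    exact D.circleCount_pos _ (Or.inl ⟨p, hp⟩)
  · exact Or.inl (Finset.nonempty_iff_ne_empty.2 h)

theorem circleCount_addCircle (D : MultiDiagram) (s : ℕ → Resolution) (h : D.IsNonempty) :
    D.addCircle.circleCount s = D.circleCount s + 1 := by
  have h1 : D.addCircle.curve.numColorings (D.addCircle.Compatible s) =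
      D.curve.numColorings (D.Compatible s) * 2 := by
    change 2 ^ (D.curve.circles + 1) * _ = 2 ^ D.curve.circles * _ * 2
    rw [pow_succ]
    exact mul_right_comm _ _ _
  have h2 := D.two_le_numColorings s h
  rw [circleCount, h1, Nat.log_mul_base (by norm_num) (by omega), circleCount]

/-! ### The state sum -/

/-- The state in which the chords in `M` become half-twisted bands, those in `J` but not in `M`
become untwisted bands, and the others are removed. -/
def state (J M : Finset ℕ) (v : ℕ) : Resolution :=
  if v ∈ M then .twisted else if v ∈ J then .untwisted else .removed

/-- The state sum with weights `a`, `-a` and `e` for an untwisted band, a half-twisted band and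
a removed chord. The truncated subtraction in the exponent matters only for the empty diagram. -/
noncomputable def stateSum {R : Type*} [CommRing R] (a b e : R) (D : MultiDiagram) : R :=
  ∑ J ∈ D.chords.powerset, ∑ M ∈ J.powerset,
    e ^ (D.chords \ J).card * a ^ J.card * (-1) ^ M.card * b ^ (D.circleCount (state J M) - 1)

theorem stateSum_skein {R : Type*} [CommRing R] (a b e : R) (D : MultiDiagram) (p : ℕ)
    (hp : p ∈ D.pts) :
    stateSum a b e D = a * stateSum a b e (D.resolve .untwisted p hp) -
      a * stateSum a b e (D.resolve .twisted p hp) +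
      e * stateSum a b e (D.resolve .removed p hp) := by
  have hv := D.min_mem_chords p hp
  have hc := D.circleCount_resolve
  set v := min p (D.mate p) with hvdef
  obtain ⟨T, hT', hDT⟩ : ∃ T, v ∉ T ∧ D.chords = insert v T :=
    ⟨D.chords.erase v, Finset.notMem_erase _ _, (Finset.insert_erase hv).symm⟩
  have hrT : ∀ r, (D.resolve r p hp).chords = T := by
    intro r
    rw [chords_resolve, hDT, ← hvdef, Finset.erase_insert hT']
  simp only [stateSum, hrT, hDT]
  -- The sets `J` that contain `v` give the two band terms, the others the removal term.
  rw [Finset.sum_powerset_insert hT', add_comm, Finset.mul_sum, Finset.mul_sum, Finset.mul_sum,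
    ← Finset.sum_sub_distrib]
  congr 1
  · refine Finset.sum_congr rfl fun J hJ => ?_
    have hJT := Finset.mem_powerset.1 hJ
    have hvJ : v ∉ J := fun h => hT' (hJT h)
    rw [Finset.sum_powerset_insert hvJ, Finset.mul_sum, Finset.mul_sum, ← Finset.sum_add_distrib,
      ← Finset.sum_sub_distrib]
    refine Finset.sum_congr rfl fun M hM => ?_
    have hvM : v ∉ M := fun h => hvJ (Finset.mem_powerset.1 hM h)
    have e1 : D.circleCount (state (insert v J) M) =
        (D.resolve .untwisted p hp).circleCount (state J M) := by
      rw [hc _ p hp .untwisted (by simp [state, ← hvdef, hvM])]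
      apply circleCount_congr
      intro w hw
      have : w ≠ v := by rintro rfl; rw [hrT] at hw; exact hT' hw
      simp [state, this]
    have e2 : D.circleCount (state (insert v J) (insert v M)) =
        (D.resolve .twisted p hp).circleCount (state J M) := by
      rw [hc _ p hp .twisted (by simp [state, ← hvdef])]
      apply circleCount_congr
      intro w hw
      have : w ≠ v := by rintro rfl; rw [hrT] at hw; exact hT' hw
      simp [state, this]
    have e3 : insert v T \ insert v J = T \ J := by
      ext w
      simp only [Finset.mem_sdiff, Finset.mem_insert]
      grind
    rw [e1, e2, e3, Finset.card_insert_of_notMem hvJ, Finset.card_insert_of_notMem hvM]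
    ring
  · refine Finset.sum_congr rfl fun J hJ => ?_
    have hJT := Finset.mem_powerset.1 hJ
    have hvJ : v ∉ J := fun h => hT' (hJT h)
    rw [Finset.mul_sum]
    refine Finset.sum_congr rfl fun M hM => ?_
    have hvM : v ∉ M := fun h => hvJ (Finset.mem_powerset.1 hM h)
    rw [hc _ p hp .removed (by simp [state, ← hvdef, hvM, hvJ]), Finset.insert_sdiff_of_notMem _ hvJ,
      Finset.card_insert_of_notMem (by simp [hT'])]
    ring

theorem stateSum_addCircle {R : Type*} [CommRing R] (a b e : R) (D : MultiDiagram)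
    (h : D.IsNonempty) : stateSum a b e D.addCircle = b * stateSum a b e D := by
  have : D.addCircle.chords = D.chords := rfl
  simp only [stateSum, this, Finset.mul_sum]
  refine Finset.sum_congr rfl fun J _ => Finset.sum_congr rfl fun M _ => ?_
  obtain ⟨n, hn⟩ := Nat.exists_eq_add_one_of_ne_zero (D.circleCount_pos (state J M) h).ne'
  rw [circleCount_addCircle D _ h, hn, Nat.add_sub_cancel, Nat.add_sub_cancel]
  ring

theorem stateSum_of_pts_eq_empty {R : Type*} [CommRing R] (a b e : R) (D : MultiDiagram)
    (h : D.pts = ∅) : stateSum a b e D = b ^ (D.curve.circles - 1) := by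
  simp [stateSum, D.chords_eq_empty h, D.circleCount_of_pts_eq_empty _ h]

theorem eq_of_pts_eq_empty {D E : MultiDiagram} (hD : D.pts = ∅) (hE : E.pts = ∅)
    (h : D.curve.circles = E.curve.circles) : D = E := by
  obtain ⟨P, m, h1, h2, h3, h4, ⟨S, arc, c, k1, k2, k3, k4⟩, hs⟩ := D
  obtain ⟨P', m', h1', h2', h3', h4', ⟨S', arc', c', k1', k2', k3', k4'⟩, hs'⟩ := E
  simp only at hD hE h hs hs'
  subst hD hE h hs hs'
  obtain rfl : m = m' := funext fun p => by rw [h4 p (by simp), h4' p (by simp)]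
  obtain rfl : arc = arc' := funext fun p => by rw [k4 p (by simp), k4' p (by simp)]
  rfl

/-- The skein relation and the values on circles without chords determine a function on nonempty
diagrams. Nothing is claimed for the empty diagram, which never arises from a nonempty one. -/
theorem eq_stateSum {R : Type*} [CommRing R] {a b e : R} {K : MultiDiagram → R}
    (hskein : ∀ (D : MultiDiagram) (p : ℕ) (hp : p ∈ D.pts),
      K D = a * K (D.resolve .untwisted p hp) - a * K (D.resolve .twisted p hp) +
        e * K (D.resolve .removed p hp))
    (hadd : ∀ D : MultiDiagram, D.IsNonempty → K D.addCircle = b * K D)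
    (hcircle : K circle = 1) (D : MultiDiagram) (hD : D.IsNonempty) :
    K D = stateSum a b e D := by
  induction hn : D.pts.card using Nat.strong_induction_on generalizing D with
  | _ n ih =>
    by_cases hpts : D.pts = ∅
    · have hc : ∀ (m : ℕ) (E : MultiDiagram), E.pts = ∅ → E.curve.circles = m + 1 →
          K E = b ^ m := by
        intro m
        induction m with
        | zero =>
          intro E hE hm
          rw [eq_of_pts_eq_empty hE (E := circle) rfl hm, hcircle, pow_zero]
        | succ m ihm =>
          intro E hE hm
          let F : MultiDiagram := { E with curve := { E.curve with circles := m + 1 } }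
          have hF : E = F.addCircle := eq_of_pts_eq_empty hE hE hm
          rw [hF, hadd F (Or.inr (Nat.succ_pos m)), ihm F hE rfl, pow_succ']
      have h0 : 0 < D.curve.circles := hD.resolve_left (by simp [hpts])
      rw [stateSum_of_pts_eq_empty a b e D hpts, hc (D.curve.circles - 1) D hpts (by omega)]
    · obtain ⟨p, hp⟩ := Finset.nonempty_iff_ne_empty.2 hpts
      have h : ∀ r, K (D.resolve r p hp) = stateSum a b e (D.resolve r p hp) := by
        intro r
        refine ih _ ?_ _ (D.isNonempty_resolve r p hp) rfl
        rw [← hn]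
        refine Finset.card_lt_card ⟨?_, fun hsub => ?_⟩
        · exact (Finset.erase_subset _ _).trans (Finset.erase_subset _ _)
        · have := hsub hp
          simp [resolve] at this
      rw [hskein D p hp, stateSum_skein a b e D p hp, h, h, h]

theorem stateSum_circle {R : Type*} [CommRing R] (a b e : R) : stateSum a b e circle = 1 := by
  rw [stateSum_of_pts_eq_empty a b e circle rfl]
  simp [circle]

theorem isFramedKauffman_stateSum {R : Type*} [CommRing R] (a b : R) :
    IsFramedKauffman a b (stateSum a b 0) where
  skein D p hp := by rw [stateSum_skein a b 0 D p hp]; ring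
  addCircle := stateSum_addCircle a b 0
  circle := stateSum_circle a b 0

theorem isUnframedKauffman_stateSum {R : Type*} [CommRing R] (a b : R) :
    IsUnframedKauffman a b (stateSum a b (-(a * (b - 1)))) where
  skein D p hp := by rw [stateSum_skein a b _ D p hp]; ring
  addCircle := stateSum_addCircle a b _
  circle := stateSum_circle a b _

end MultiDiagram

theorem IsFramedKauffman.eq_stateSum {R : Type*} [CommRing R] {a b : R} {K : MultiDiagram → R}
    (hK : IsFramedKauffman a b K) (D : MultiDiagram) (hD : D.IsNonempty) :
    K D = MultiDiagram.stateSum a b 0 D :=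
  MultiDiagram.eq_stateSum (fun D p hp => by rw [hK.skein D p hp]; ring) hK.addCircle hK.circle
    D hD

theorem IsUnframedKauffman.eq_stateSum {R : Type*} [CommRing R] {a b : R} {K : MultiDiagram → R}
    (hK : IsUnframedKauffman a b K) (D : MultiDiagram) (hD : D.IsNonempty) :
    K D = MultiDiagram.stateSum a b (-(a * (b - 1))) D :=
  MultiDiagram.eq_stateSum (fun D p hp => by rw [hK.skein D p hp]; ring) hK.addCircle hK.circle
    D hD

/-! ### The kernel of the marked interlacement matrix -/

open Classical in
/-- `x`, extended by zero outside `J`, is in the kernel of the adjacency matrix over `ℤ/2` of `adj` on `J`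
with ones on the diagonal at `M`. -/
def IsMarkedKernel (adj : ℕ → ℕ → Prop) (J M : Finset ℕ) (x : ℕ → ZMod 2) : Prop :=
  (∀ p, p ∉ J → x p = 0) ∧
    ∀ p ∈ J, ∑ q ∈ J, (if adj p q then x q else 0) + (if p ∈ M then x p else 0) = 0

/-- The number of elements of the kernel of the adjacency matrix of `adj` on `J`, marked at `M`. -/
noncomputable def kernelCard (adj : ℕ → ℕ → Prop) (J M : Finset ℕ) : ℕ :=
  Nat.card {x : ℕ → ZMod 2 // IsMarkedKernel adj J M x}

instance (adj : ℕ → ℕ → Prop) (J M : Finset ℕ) :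
    Finite {x : ℕ → ZMod 2 // IsMarkedKernel adj J M x} := by
  refine Finite.of_injective (β := J → ZMod 2) (fun f x => f.1 x) ?_
  rintro ⟨f, hf, hf'⟩ ⟨g, hg, hg'⟩ h
  refine Subtype.ext (funext fun x => ?_)
  by_cases hx : x ∈ J
  · exact congrFun h ⟨x, hx⟩
  · exact (hf x hx).trans (hg x hx).symm

theorem kernelCard_ne_zero (adj : ℕ → ℕ → Prop) (J M : Finset ℕ) : kernelCard adj J M ≠ 0 := by
  have : Nonempty {x : ℕ → ZMod 2 // IsMarkedKernel adj J M x} :=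
    ⟨⟨0, fun _ _ => rfl, fun p _ => by simp⟩⟩
  exact Nat.card_pos.ne'

theorem kernelCard_congr {adj adj' : ℕ → ℕ → Prop} (J M : Finset ℕ)
    (h : ∀ p ∈ J, ∀ q ∈ J, adj p q ↔ adj' p q) : kernelCard adj J M = kernelCard adj' J M := by
  classical
  have : IsMarkedKernel adj J M = IsMarkedKernel adj' J M := by
    funext x
    refine propext (and_congr_right fun _ => forall₂_congr fun p hp => ?_)
    rw [Finset.sum_congr rfl fun q hq => if_congr (h p hp q hq) rfl rfl]
  rw [kernelCard, kernelCard, this]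

namespace ChordDiagram

/-- The endpoints of the chords named `p` and `q` alternate. -/
def Interlace (D : ChordDiagram) (p q : ℕ) : Prop :=
  (p < q ∧ q < D.mate p ∧ D.mate p < D.mate q) ∨ (q < p ∧ p < D.mate q ∧ D.mate q < D.mate p)

/-- Every endpoint belongs to exactly one chord. -/
theorem sum_pts (D : ChordDiagram) {A : Type*} [AddCommMonoid A] (g : ℕ → A) :
    ∑ r ∈ D.pts, g r = ∑ v ∈ D.chords, (g v + g (D.mate v)) := by
  have h1 := D.mate_mem
  have h2 := D.mate_mate
  have h3 := D.mate_ne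
  rw [Finset.sum_add_distrib, ← Finset.sum_filter_add_sum_filter_not D.pts (fun p => p < D.mate p)]
  congr 1
  refine Finset.sum_nbij' D.mate D.mate ?_ ?_ ?_ ?_ ?_ <;>
    simp only [chords, Finset.mem_filter] <;> grind

/-! ### Colourings of a chord diagram on one circle -/

/-- The jump at an endpoint of a colouring whose jumps at the endpoints of the chord `v` are both `x v`.
The function `x` vanishes outside the set of names, so at most one summand is nonzero. -/
def jump (D : ChordDiagram) (x : ℕ → ZMod 2) (p : ℕ) : ZMod 2 := x p + x (D.mate p)

theorem mate_notMem_chords (D : ChordDiagram) {v : ℕ} (hv : v ∈ D.chords) :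
    D.mate v ∉ D.chords := by
  have h2 := D.mate_mate
  simp only [chords, Finset.mem_filter] at hv ⊢
  grind

theorem jump_chord (D : ChordDiagram) {x : ℕ → ZMod 2} (hx : ∀ p, p ∉ D.chords → x p = 0) {v : ℕ}
    (hv : v ∈ D.chords) : D.jump x v = x v := by
  rw [jump, hx _ (D.mate_notMem_chords hv), add_zero]

theorem jump_mate_chord (D : ChordDiagram) {x : ℕ → ZMod 2} (hx : ∀ p, p ∉ D.chords → x p = 0)
    {v : ℕ} (hv : v ∈ D.chords) : D.jump x (D.mate v) = x v := by
  rw [jump, hx _ (D.mate_notMem_chords hv), zero_add, D.mate_mate]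

theorem sum_jump (D : ChordDiagram) (x : ℕ → ZMod 2) : ∑ r ∈ D.pts, D.jump x r = 0 := by
  rw [sum_pts]
  refine Finset.sum_eq_zero fun v _ => ?_
  rw [jump, jump, D.mate_mate, add_comm (x (D.mate v)) (x v)]
  exact CharTwo.add_self_eq_zero _

open Classical in
/-- Modulo 2, a chord contributes to the sum of the jumps between the endpoints of `v` exactly if one of
its endpoints lies there, that is, if it interlaces `v`. -/
theorem sum_jump_between (D : ChordDiagram) {x : ℕ → ZMod 2}
    (hx : ∀ p, p ∉ D.chords → x p = 0) {v : ℕ} (hv : v ∈ D.chords) :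
    ∑ r ∈ D.pts with v < r ∧ r < D.mate v, D.jump x r =
      ∑ q ∈ D.chords, (if D.Interlace v q then x q else 0) := by
  rw [Finset.sum_filter, sum_pts]
  refine Finset.sum_congr rfl fun q hq => ?_
  rw [D.jump_chord hx hq, D.jump_mate_chord hx hq]
  have h2 := D.mate_mate
  have hcc : x q + x q = 0 := CharTwo.add_self_eq_zero _
  simp only [chords, Finset.mem_filter] at hv hq
  unfold Interlace
  rcases eq_or_ne q v with rfl | hqv
  · simp
  · have : D.mate q ≠ D.mate v := fun h => hqv (by rw [← h2 q, h, h2])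
    have : D.mate q ≠ v := fun h => by have := h2 q; grind
    grind

/-- The value just before `p` of the function that starts with `c` at the base point and has the jumps
prescribed by `x`. -/
def height (D : ChordDiagram) (c : ZMod 2) (x : ℕ → ZMod 2) (p : ℕ) : ZMod 2 :=
  c + ∑ r ∈ D.pts with r < p, D.jump x r

theorem height_of_isLeast (D : ChordDiagram) (c : ZMod 2) (x : ℕ → ZMod 2) (p : ℕ)
    (h : ∀ q ∈ D.pts, p ≤ q) : D.height c x p = c := by
  rw [height, Finset.filter_false_of_mem fun q hq => not_lt.2 (h q hq), Finset.sum_empty, add_zero]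

/-- This includes the step across the base point, because the jumps sum to zero over the circle. -/
theorem height_cyclicNext (D : ChordDiagram) (c : ZMod 2) (x : ℕ → ZMod 2) (p : ℕ)
    (hp : p ∈ D.pts) : D.height c x (cyclicNext D.pts p) = D.height c x p + D.jump x p := by
  have h0 : D.height c x p + D.jump x p = c + ∑ r ∈ D.pts with r ≤ p, D.jump x r := by
    have : D.pts.filter (· ≤ p) = insert p (D.pts.filter (· < p)) := by
      ext r
      simp only [Finset.mem_filter, Finset.mem_insert]
      grind
    rw [height, this, Finset.sum_insert (by simp)]
    ring
  rw [h0]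
  rcases cyclicNext_spec D.pts p hp with ⟨h1, h2⟩ | ⟨h1, h2⟩
  · rw [height]
    congr 2
    refine Finset.filter_congr fun r hr => ?_
    have := h2 r hr
    grind
  · rw [height_of_isLeast D c x _ h2, Finset.filter_true_of_mem h1, sum_jump, add_zero]

open Classical in
theorem height_mate (D : ChordDiagram) (c : ZMod 2) {x : ℕ → ZMod 2}
    (hx : ∀ p, p ∉ D.chords → x p = 0) {v : ℕ} (hv : v ∈ D.chords) :
    D.height c x (D.mate v) =
      D.height c x v + x v + ∑ q ∈ D.chords, (if D.Interlace v q then x q else 0) := by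
  rw [← D.sum_jump_between hx hv, height, height, ← D.jump_chord hx hv]
  simp only [chords, Finset.mem_filter] at hv
  have : D.pts.filter (· < D.mate v) = insert v ((D.pts.filter (· < v)) ∪
      (D.pts.filter (fun r => v < r ∧ r < D.mate v))) := by
    ext r
    simp only [Finset.mem_filter, Finset.mem_insert, Finset.mem_union]
    grind
  rw [this, Finset.sum_insert (by simp), Finset.sum_union]
  · ring
  · rw [Finset.disjoint_left]
    simp only [Finset.mem_filter]
    grind

/-- The colouring with initial value `c` and the jumps prescribed by `x`. -/
def heightColoring (D : ChordDiagram) (c : ZMod 2) (x : ℕ → ZMod 2) (s : Side) : ZMod 2 :=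
  if s.1 ∈ D.pts then D.height c x s.1 + (if s.2 = true then D.jump x s.1 else 0) else 0

theorem isColoring_iff (D : ChordDiagram) (f : Side → ZMod 2) :
    D.toMulti.curve.IsColoring f ↔ (∀ s : Side, s.1 ∉ D.pts → f s = 0) ∧
      ∀ p ∈ D.pts, f (cyclicNext D.pts p, false) = f (p, true) := by
  refine and_congr ?_ ?_
  · exact forall_congr' fun s => by rw [D.toMulti.mem_sides_iff]; rfl
  · simp only [toMulti]
    constructor
    · intro h p hp
      simpa [hp] using h (p, true)
    · rintro h ⟨p, i⟩
      by_cases hp : p ∈ D.pts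
      · cases i
        · have := h _ (cyclicPrev_mem D.pts p hp)
          rw [cyclicNext_prev D.pts p hp] at this
          simp [hp, this]
        · simp [hp, h p hp]
      · simp [hp]

theorem isColoring_heightColoring (D : ChordDiagram) (c : ZMod 2) (x : ℕ → ZMod 2) :
    D.toMulti.curve.IsColoring (D.heightColoring c x) := by
  rw [isColoring_iff]
  refine ⟨fun s hs => if_neg hs, fun p hp => ?_⟩
  simp [heightColoring, hp, cyclicNext_mem D.pts p hp, height_cyclicNext]

theorem chords_toMulti (D : ChordDiagram) : D.toMulti.chords = D.chords := rfl

open MultiDiagram in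
/-- For `v` in `J` both gluing equations of `v` amount to the kernel equation in row `v`; for a removed
chord they only say that there is no jump. -/
theorem compatible_heightColoring_iff (D : ChordDiagram) {J M : Finset ℕ} (hJ : J ⊆ D.chords)
    (hM : M ⊆ J) (c : ZMod 2) {x : ℕ → ZMod 2} (hx : ∀ p, p ∉ J → x p = 0) :
    D.toMulti.Compatible (state J M) (D.heightColoring c x) ↔ IsMarkedKernel D.Interlace J M x := by
  classical
  have hx' : ∀ p, p ∉ D.chords → x p = 0 := fun p hp => hx p fun h => hp (hJ h)
  have hs : ∀ v, ∑ q ∈ D.chords, (if D.Interlace v q then x q else 0) =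
      ∑ q ∈ J, (if D.Interlace v q then x q else 0) := by
    intro v
    refine (Finset.sum_subset hJ fun q _ hq => ?_).symm
    rw [hx q hq, ite_self]
  have key : ∀ v ∈ D.chords, (D.heightColoring c x (v, true) =
        D.heightColoring c x ((state J M v).partner v (D.mate v)) ∧
      D.heightColoring c x ((state J M v).rest₁ v (D.mate v)) =
        D.heightColoring c x ((state J M v).rest₂ v (D.mate v))) ↔
      (v ∈ J → ∑ q ∈ J, (if D.Interlace v q then x q else 0) + (if v ∈ M then x v else 0) = 0) := by
    intro v hv
    have hp : v ∈ D.pts := (Finset.mem_filter.1 hv).1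
    have hp' := D.mate_mem v hp
    have h1 : ∀ i, D.heightColoring c x (v, i) = D.height c x v + if i = true then x v else 0 := by
      intro i
      simp only [heightColoring, hp, if_true, D.jump_chord hx' hv]
    have h2 : ∀ i, D.heightColoring c x (D.mate v, i) = D.height c x v + x v +
        ∑ q ∈ J, (if D.Interlace v q then x q else 0) + if i = true then x v else 0 := by
      intro i
      simp only [heightColoring, hp', if_true, D.jump_mate_chord hx' hv, D.height_mate c hx' hv, hs]
    generalize ∑ q ∈ J, (if D.Interlace v q then x q else 0) = S at *
    have hS : S + S = 0 := CharTwo.add_self_eq_zero _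
    have hX : x v + x v = 0 := CharTwo.add_self_eq_zero _
    by_cases hvM : v ∈ M
    · have hvJ := hM hvM
      simp only [state, hvM, hvJ, if_true, Resolution.partner, Resolution.rest₁, Resolution.rest₂,
        h1, h2]
      grind
    · by_cases hvJ : v ∈ J
      · simp only [state, hvM, hvJ, if_true, if_false, Resolution.partner, Resolution.rest₁,
          Resolution.rest₂, h1, h2]
        grind
      · have := hx v hvJ
        simp only [state, hvM, hvJ, if_false, Resolution.partner, Resolution.rest₁,
          Resolution.rest₂, h1, h2]
        grind
  constructor
  · exact fun h => ⟨hx, fun v hv => (key v (hJ hv)).1 (h v (hJ hv)) hv⟩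
  · exact fun h v hv => (key v hv).2 (h.2 v)

open MultiDiagram in
/-- The gluing equations force equal jumps at the two endpoints of a chord, and none at a removed chord,
so every compatible colouring arises by summing its jumps. -/
theorem exists_heightColoring_eq (D : ChordDiagram) {J M : Finset ℕ} (hJ : J ⊆ D.chords)
    (hM : M ⊆ J) {f : Side → ZMod 2} (hf : D.toMulti.curve.IsColoring f)
    (hc : D.toMulti.Compatible (state J M) f) :
    ∃ c x, (∀ p, p ∉ J → x p = 0) ∧ D.heightColoring c x = f := by
  classical
  rw [isColoring_iff] at hf
  obtain ⟨hf0, hf1⟩ := hf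
  let x : ℕ → ZMod 2 := fun p => if p ∈ J then f (p, true) + f (p, false) else 0
  have hx : ∀ p, p ∉ J → x p = 0 := fun p hp => if_neg hp
  have hx' : ∀ p, p ∉ D.chords → x p = 0 := fun p hp => hx p fun h => hp (hJ h)
  have two : ∀ t : ZMod 2, t + t = 0 := CharTwo.add_self_eq_zero
  have hch : ∀ v ∈ D.chords, f (v, true) = f (v, false) + x v ∧
      f (D.mate v, true) = f (D.mate v, false) + x v := by
    intro v hv
    have h := hc v hv
    change _ = f (Resolution.partner _ v (D.mate v)) ∧
      f (Resolution.rest₁ _ v (D.mate v)) = f (Resolution.rest₂ _ v (D.mate v)) at h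
    have := two (f (v, true))
    have := two (f (v, false))
    have := two (f (D.mate v, true))
    have := two (f (D.mate v, false))
    have hxv : x v = if v ∈ J then f (v, true) + f (v, false) else 0 := rfl
    by_cases hvM : v ∈ M
    · have hvJ := hM hvM
      simp only [state, hvM, hvJ, if_true, Resolution.partner, Resolution.rest₁,
        Resolution.rest₂] at h hxv
      grind
    · by_cases hvJ : v ∈ J
      · simp only [state, hvM, hvJ, if_true, if_false, Resolution.partner, Resolution.rest₁,
          Resolution.rest₂] at h hxv
        grind
      · simp only [state, hvM, hvJ, if_false, Resolution.partner, Resolution.rest₁,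
          Resolution.rest₂] at h hxv
        grind
  have hjump : ∀ p ∈ D.pts, f (p, true) = f (p, false) + D.jump x p := by
    intro p hp
    rcases lt_or_gt_of_ne (D.mate_ne p hp) with h | h
    · have hv : D.mate p ∈ D.chords :=
        Finset.mem_filter.2 ⟨D.mate_mem p hp, by rwa [D.mate_mate]⟩
      have h1 := (hch _ hv).2
      have h2 := D.jump_mate_chord hx' hv
      rw [D.mate_mate] at h1 h2
      rw [h1, h2]
    · have hv : p ∈ D.chords := Finset.mem_filter.2 ⟨hp, h⟩
      rw [(hch _ hv).1, D.jump_chord hx' hv]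
  -- The initial value `c` is the value just before the smallest endpoint.
  have hheight : ∃ c, ∀ p ∈ D.pts, f (p, false) = D.height c x p := by
    by_cases hne : D.pts.Nonempty
    · refine ⟨f (D.pts.min' hne, false), fun p => ?_⟩
      induction p using Nat.strong_induction_on with
      | _ p ih =>
        intro hp
        rcases cyclicPrev_spec D.pts p hp with ⟨h1, -⟩ | ⟨h1, -⟩
        · have hq := cyclicPrev_mem D.pts p hp
          have h2 := hf1 _ hq
          have h3 := D.height_cyclicNext (f (D.pts.min' hne, false)) x _ hq
          rw [cyclicNext_prev D.pts p hp] at h2 h3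
          rw [h2, h3, hjump _ hq, ih _ h1 hq]
        · rw [height_of_isLeast D _ x p h1,
            le_antisymm (h1 _ (D.pts.min'_mem hne)) (D.pts.min'_le p hp)]
    · exact ⟨0, fun p hp => absurd ⟨p, hp⟩ hne⟩
  obtain ⟨c, hc'⟩ := hheight
  refine ⟨c, x, hx, funext ?_⟩
  rintro ⟨p, i⟩
  by_cases hp : p ∈ D.pts
  · cases i
    · simp [heightColoring, hp, hc' p hp]
    · simp [heightColoring, hp, hjump p hp, hc' p hp]
  · simp [heightColoring, hp, hf0 (p, i) hp]

theorem heightColoring_injective (D : ChordDiagram) (hD : D.pts.Nonempty) {c c' : ZMod 2}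
    {x x' : ℕ → ZMod 2} (hx : ∀ p, p ∉ D.chords → x p = 0) (hx' : ∀ p, p ∉ D.chords → x' p = 0)
    (h : D.heightColoring c x = D.heightColoring c' x') : c = c' ∧ x = x' := by
  have h1 : ∀ p ∈ D.pts, D.height c x p = D.height c' x' p := by
    intro p hp
    simpa [heightColoring, hp] using congrFun h (p, false)
  refine ⟨?_, funext fun p => ?_⟩
  · have hm := h1 _ (D.pts.min'_mem hD)
    rwa [height_of_isLeast D _ _ _ (fun q hq => D.pts.min'_le q hq),
      height_of_isLeast D _ _ _ (fun q hq => D.pts.min'_le q hq)] at hm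
  · by_cases hp : p ∈ D.chords
    · have hp' : p ∈ D.pts := (Finset.mem_filter.1 hp).1
      have h2 := congrFun h (p, true)
      simp only [heightColoring, hp', if_true, h1 p hp', D.jump_chord hx hp,
        D.jump_chord hx' hp] at h2
      exact add_left_cancel h2
    · rw [hx p hp, hx' p hp]

open MultiDiagram in
/-- A compatible colouring corresponds to its value at the base point and an element of the kernel.
Without endpoints, the value at the base point is that on the single circle. -/
theorem numColorings_state (D : ChordDiagram) {J M : Finset ℕ} (hJ : J ⊆ D.chords) (hM : M ⊆ J) :
    D.toMulti.curve.numColorings (D.toMulti.Compatible (state J M)) =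
      2 * kernelCard D.Interlace J M := by
  rcases D.pts.eq_empty_or_nonempty with hD | hD
  · have hJ0 : J = ∅ := by
      rw [← Finset.subset_empty]
      exact hJ.trans (by simp [chords, hD])
    subst hJ0
    have h1 : D.toMulti.curve.circles = 1 := if_pos hD
    have : Subsingleton {x : ℕ → ZMod 2 // IsMarkedKernel D.Interlace ∅ M x} :=
      ⟨fun x y => Subtype.ext (funext fun p => by rw [x.2.1 p (by simp), y.2.1 p (by simp)])⟩
    have h2 := Finite.card_le_one_iff_subsingleton.2 this
    have h3 := kernelCard_ne_zero D.Interlace ∅ M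
    have : Subsingleton {f : Side → ZMod 2 // D.toMulti.curve.IsColoring f ∧
        D.toMulti.Compatible (state ∅ M) f} :=
      ⟨fun x y => Subtype.ext (funext fun p => by
        have hp : p ∉ D.toMulti.curve.sides := by
          rw [mem_sides_iff]
          change p.1 ∉ D.pts
          simp [hD]
        rw [x.2.1.1 p hp, y.2.1.1 p hp])⟩
    have h4 := Finite.card_le_one_iff_subsingleton.2 this
    have h5 := D.toMulti.two_le_numColorings (state ∅ M) (Or.inr (by omega))
    unfold CurveSystem.numColorings kernelCard at *
    rw [h1, pow_one] at *
    omega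
  · have h0 : D.toMulti.curve.circles = 0 := if_neg hD.ne_empty
    rw [CurveSystem.numColorings, h0, pow_zero, one_mul, kernelCard]
    have hsupp : ∀ x : ℕ → ZMod 2, IsMarkedKernel D.Interlace J M x →
        ∀ p, p ∉ D.chords → x p = 0 := fun x hx p hp => hx.1 p fun h => hp (hJ h)
    let Φ : ZMod 2 × {x : ℕ → ZMod 2 // IsMarkedKernel D.Interlace J M x} →
        {f : Side → ZMod 2 // D.toMulti.curve.IsColoring f ∧
          D.toMulti.Compatible (state J M) f} := fun q =>
      ⟨D.heightColoring q.1 q.2.1, D.isColoring_heightColoring _ _,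
        (D.compatible_heightColoring_iff hJ hM _ q.2.2.1).2 q.2.2⟩
    have hΦ : Function.Bijective Φ := by
      constructor
      · rintro ⟨c, x, hx⟩ ⟨c', x', hx'⟩ h
        obtain ⟨rfl, rfl⟩ := D.heightColoring_injective hD (hsupp x hx) (hsupp x' hx')
          (congrArg Subtype.val h)
        rfl
      · rintro ⟨f, hf, hc⟩
        obtain ⟨c, x, hx, rfl⟩ := D.exists_heightColoring_eq hJ hM hf hc
        exact ⟨(c, ⟨x, (D.compatible_heightColoring_iff hJ hM c hx).1 hc⟩), rfl⟩
    rw [← Nat.card_congr (Equiv.ofBijective Φ hΦ), Nat.card_prod, Nat.card_zmod]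

open MultiDiagram in
theorem circleCount_state (D : ChordDiagram) {J M : Finset ℕ} (hJ : J ⊆ D.chords) (hM : M ⊆ J) :
    D.toMulti.circleCount (state J M) = Nat.log 2 (kernelCard D.Interlace J M) + 1 := by
  rw [circleCount, D.numColorings_state hJ hM, mul_comm,
    Nat.log_mul_base (by norm_num) (kernelCard_ne_zero _ _ _)]

theorem isNonempty_toMulti (D : ChordDiagram) : D.toMulti.IsNonempty := by
  rcases D.pts.eq_empty_or_nonempty with h | h
  · exact Or.inr (by simp [toMulti, h])
  · exact Or.inl h

end ChordDiagram

/-! ### Isolated vertices -/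

theorem kernelCard_insert_unmarked (adj : ℕ → ℕ → Prop) {J M : Finset ℕ} {v : ℕ} (hv : v ∉ J)
    (hM : v ∉ M) (h1 : ∀ q ∈ insert v J, ¬ adj v q) (h2 : ∀ q ∈ J, ¬ adj q v) :
    kernelCard adj (insert v J) M = 2 * kernelCard adj J M := by
  classical
  have row : ∀ (x : ℕ → ZMod 2) (c : ZMod 2), ∀ p ∈ J,
      ∑ q ∈ insert v J, (if adj p q then x q else 0) + (if p ∈ M then x p else 0) =
        ∑ q ∈ J, (if adj p q then Function.update x v c q else 0) +
          (if p ∈ M then Function.update x v c p else 0) := by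
    intro x c p hp
    rw [Finset.sum_insert hv, if_neg (h2 p hp), zero_add,
      Function.update_of_ne (show p ≠ v from fun h => hv (h ▸ hp))]
    congr 1
    refine Finset.sum_congr rfl fun q hq => ?_
    rw [Function.update_of_ne (show q ≠ v from fun h => hv (h ▸ hq))]
  have e : {x : ℕ → ZMod 2 // IsMarkedKernel adj (insert v J) M x} ≃
      ZMod 2 × {x : ℕ → ZMod 2 // IsMarkedKernel adj J M x} :=
    { toFun := fun x => (x.1 v, ⟨Function.update x.1 v 0, by
        obtain ⟨x, hx0, hx⟩ := x
        refine ⟨fun p hp => ?_, fun p hp => ?_⟩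
        · by_cases hpv : p = v
          · simp [hpv]
          · simpa [hpv] using hx0 p (by simp [hp, hpv])
        · exact (row x 0 p hp).symm.trans (hx p (Finset.mem_insert_of_mem hp))⟩)
      invFun := fun q => ⟨Function.update q.2.1 v q.1, by
        obtain ⟨c, x, hx0, hx⟩ := q
        refine ⟨fun p hp => ?_, fun p hp => ?_⟩
        · rw [Finset.mem_insert, not_or] at hp
          simpa [hp.1] using hx0 p hp.2
        · rcases Finset.mem_insert.1 hp with rfl | hp
          · rw [Finset.sum_eq_zero fun q hq => if_neg (h1 q hq), if_neg hM, zero_add]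
          · refine (row (Function.update x v c) (x v) p hp).trans ?_
            rw [Function.update_idem, Function.update_eq_self]
            exact hx p hp⟩
      left_inv := fun x => Subtype.ext (by simp)
      right_inv := by
        rintro ⟨c, x, hx0, hx⟩
        refine Prod.ext (by simp) (Subtype.ext ?_)
        simp [← hx0 v hv] }
  rw [kernelCard, Nat.card_congr e, Nat.card_prod, Nat.card_zmod, kernelCard]

theorem kernelCard_insert_marked (adj : ℕ → ℕ → Prop) {J M : Finset ℕ} {v : ℕ} (hv : v ∉ J)
    (h1 : ∀ q ∈ insert v J, ¬ adj v q) (h2 : ∀ q ∈ J, ¬ adj q v) :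
    kernelCard adj (insert v J) (insert v M) = kernelCard adj J M := by
  classical
  have : IsMarkedKernel adj (insert v J) (insert v M) = IsMarkedKernel adj J M := by
    funext x
    refine propext ⟨fun hx => ?_, fun hx => ?_⟩
    · have hxv : x v = 0 := by
        have := hx.2 v (Finset.mem_insert_self _ _)
        rwa [Finset.sum_eq_zero fun q hq => if_neg (h1 q hq), zero_add,
          if_pos (Finset.mem_insert_self _ _)] at this
      refine ⟨fun p hp => ?_, fun p hp => ?_⟩
      · by_cases hpv : p = v
        · rwa [hpv]
        · exact hx.1 p (by simp [hp, hpv])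
      · have hpv : p ≠ v := fun h => hv (h ▸ hp)
        have := hx.2 p (Finset.mem_insert_of_mem hp)
        simpa [Finset.sum_insert hv, h2 p hp, hpv] using this
    · refine ⟨fun p hp => hx.1 p fun h => hp (Finset.mem_insert_of_mem h), fun p hp => ?_⟩
      rcases Finset.mem_insert.1 hp with rfl | hp
      · rw [Finset.sum_eq_zero fun q hq => if_neg (h1 q hq), hx.1 p hv, ite_self, zero_add]
      · have hpv : p ≠ v := fun h => hv (h ▸ hp)
        simpa [Finset.sum_insert hv, h2 p hp, hpv] using hx.2 p hp
  rw [kernelCard, this, kernelCard]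

/-! ### Chord diagrams and deframing -/

namespace ChordDiagram

open MultiDiagram

theorem stateSum_toMulti {R : Type*} [CommRing R] (a b e : R) (D : ChordDiagram) :
    stateSum a b e D.toMulti = ∑ J ∈ D.chords.powerset, ∑ M ∈ J.powerset,
      e ^ (D.chords \ J).card * a ^ J.card * (-1) ^ M.card *
        b ^ Nat.log 2 (kernelCard D.Interlace J M) := by
  refine Finset.sum_congr rfl fun J hJ => Finset.sum_congr rfl fun M hM => ?_
  rw [D.circleCount_state (Finset.mem_powerset.1 hJ) (Finset.mem_powerset.1 hM),
    Nat.add_sub_cancel, chords_toMulti]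

/-- For `e = 0` only the states that remove no chord contribute. -/
theorem stateSum_zero_toMulti {R : Type*} [CommRing R] (a b : R) (D : ChordDiagram) :
    stateSum a b 0 D.toMulti = ∑ M ∈ D.chords.powerset,
      a ^ D.chords.card * (-1) ^ M.card * b ^ Nat.log 2 (kernelCard D.Interlace D.chords M) := by
  rw [stateSum_toMulti, Finset.sum_eq_single_of_mem D.chords (Finset.mem_powerset_self _)]
  · simp
  · intro J hJ hne
    refine Finset.sum_eq_zero fun M _ => ?_
    have : (D.chords \ J).card ≠ 0 := by
      rw [Ne, Finset.card_eq_zero, Finset.sdiff_eq_empty_iff_subset]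
      exact fun h => hne (Finset.Subset.antisymm (Finset.mem_powerset.1 hJ) h)
    rw [zero_pow this]
    ring

theorem chords_keep (D : ChordDiagram) {J : Finset ℕ} (hJ : J ⊆ D.chords) :
    (D.keep J).chords = J := by
  have h2 := D.mate_mate
  ext p
  have h3 := @hJ p
  have h4 := @hJ (D.mate p)
  simp only [chords, keep, Finset.mem_filter] at h3 h4 ⊢
  grind

theorem interlace_keep (D : ChordDiagram) {J : Finset ℕ} {p q : ℕ} (hp : p ∈ J) (hq : q ∈ J) :
    (D.keep J).Interlace p q ↔ D.Interlace p q := by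
  simp [Interlace, keep, hp, hq]

theorem chords_addTheta (D : ChordDiagram) : D.addTheta.chords = insert D.fresh D.chords := by
  have h1 := D.lt_fresh
  ext p
  have := h1 p
  simp only [chords, addTheta, Finset.mem_filter, Finset.mem_insert]
  grind

theorem fresh_notMem_chords (D : ChordDiagram) : D.fresh ∉ D.chords := fun h =>
  lt_irrefl _ (D.lt_fresh _ (Finset.mem_filter.1 h).1)

/-- The chord of `Θ` is an isolated vertex of the intersection graph. -/
theorem stateSum_addTheta {R : Type*} [CommRing R] (a b : R) (D : ChordDiagram) :
    stateSum a b 0 D.addTheta.toMulti = a * (b - 1) * stateSum a b 0 D.toMulti := by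
  have hv := D.fresh_notMem_chords
  have hlt : ∀ q ∈ D.chords, q < D.fresh ∧ D.mate q < D.fresh := fun q hq =>
    have hq' := (Finset.mem_filter.1 hq).1
    ⟨D.lt_fresh q hq', D.lt_fresh _ (D.mate_mem q hq')⟩
  have hmate : ∀ q ∈ D.chords, D.addTheta.mate q = D.mate q := by
    intro q hq
    have := (hlt q hq).1
    simp only [addTheta]
    grind
  have hf : D.addTheta.mate D.fresh = D.fresh + 1 := by simp [addTheta]
  have h2 : ∀ q ∈ D.chords, ¬ D.addTheta.Interlace q D.fresh := by
    intro q hq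
    have := hlt q hq
    simp only [Interlace, hmate q hq, hf]
    omega
  have h1 : ∀ q ∈ insert D.fresh D.chords, ¬ D.addTheta.Interlace D.fresh q := by
    intro q hq
    rcases Finset.mem_insert.1 hq with rfl | hq
    · simp [Interlace]
    · exact fun h => h2 q hq h.symm
  have h3 : ∀ M, kernelCard D.addTheta.Interlace D.chords M =
      kernelCard D.Interlace D.chords M := fun M =>
    kernelCard_congr _ _ fun p hp q hq => by simp only [Interlace, hmate p hp, hmate q hq]
  rw [stateSum_zero_toMulti, stateSum_zero_toMulti, chords_addTheta, Finset.sum_powerset_insert hv,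
    ← Finset.sum_add_distrib, Finset.mul_sum]
  refine Finset.sum_congr rfl fun M hM => ?_
  have hvM : D.fresh ∉ M := fun h => hv (Finset.mem_powerset.1 hM h)
  rw [kernelCard_insert_unmarked _ hv hvM h1 h2, kernelCard_insert_marked _ hv h1 h2, h3,
    Finset.card_insert_of_notMem hv, Finset.card_insert_of_notMem hvM, mul_comm 2,
    Nat.log_mul_base (by norm_num) (kernelCard_ne_zero _ _ _)]
  ring

theorem deframe_stateSum {R : Type*} [CommRing R] (a b : R) (D : ChordDiagram) :
    deframe (fun E => stateSum a b 0 E.toMulti) D =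
      stateSum a b (-(a * (b - 1))) D.toMulti := by
  rw [stateSum_toMulti]
  refine Finset.sum_congr rfl fun J hJ => ?_
  have hJ' := Finset.mem_powerset.1 hJ
  have hiter : ∀ (m : ℕ) (E : ChordDiagram), stateSum a b 0 (addTheta^[m] E).toMulti =
      (a * (b - 1)) ^ m * stateSum a b 0 E.toMulti := by
    intro m
    induction m with
    | zero => simp
    | succ m ih =>
      intro E
      rw [Function.iterate_succ_apply, ih, stateSum_addTheta]
      ring
  have hdeg : (D.keep (D.chords \ J)).degree = (D.chords \ J).card := by
    rw [degree, D.chords_keep Finset.sdiff_subset]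
  beta_reduce
  rw [hdeg, hiter, stateSum_zero_toMulti, D.chords_keep hJ', Finset.mul_sum, Finset.mul_sum]
  refine Finset.sum_congr rfl fun M _ => ?_
  rw [kernelCard_congr J M fun p hp q hq => D.interlace_keep hp hq, neg_pow (a * (b - 1))]
  ring

end ChordDiagram

/-! ### Ranks of marked adjacency matrices -/

theorem card_ker_mulVecLin {W : Type*} [Fintype W] [DecidableEq W] (A : Matrix W W (ZMod 2)) :
    Nat.card (LinearMap.ker A.mulVecLin) = 2 ^ (Fintype.card W - A.rank) := by
  have h := A.mulVecLin.finrank_range_add_finrank_ker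
  rw [Module.finrank_fintype_fun_eq_card] at h
  rw [Module.natCard_eq_pow_finrank (K := ZMod 2), Nat.card_zmod]
  congr 1
  change A.rank + _ = _ at h
  omega

theorem markedAdj_mulVec {W : Type*} [Fintype W] (G : SimpleGraph W) (M : Finset W)
    (y : W → ZMod 2) (i : W) [DecidableRel G.Adj] [DecidableEq W] :
    (markedAdj G M).mulVec y i =
      ∑ j, (if G.Adj i j then y j else 0) + (if i ∈ M then y i else 0) := by
  have : (if i ∈ M then y i else 0) = ∑ j, if i = j then (if i ∈ M then y i else 0) else 0 := by
    simp
  rw [this, ← Finset.sum_add_distrib]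
  refine Finset.sum_congr rfl fun j _ => ?_
  by_cases hij : i = j
  · subst hij
    simp [markedAdj]
  · simp [markedAdj, hij]

/-- The kernel on a set of natural numbers, transported to the vertex type of a graph. -/
theorem kernelCard_eq_two_pow {W : Type*} [Fintype W] (G : SimpleGraph W) (M : Finset W)
    (emb : W ↪ ℕ) (adj : ℕ → ℕ → Prop) (hadj : ∀ u v, G.Adj u v ↔ adj (emb u) (emb v)) :
    kernelCard adj (Finset.univ.map emb) (M.map emb) =
      2 ^ (Fintype.card W - (markedAdj G M).rank) := by
  classical
  have key : ∀ (x : ℕ → ZMod 2) (i : W), ∑ q ∈ Finset.univ.map emb,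
      (if adj (emb i) q then x q else 0) + (if emb i ∈ M.map emb then x (emb i) else 0) =
        (markedAdj G M).mulVec (x ∘ emb) i := by
    intro x i
    simp [markedAdj_mulVec, hadj]
  rw [← card_ker_mulVecLin, kernelCard]
  refine Nat.card_congr
    { toFun := fun x => ⟨x.1 ∘ emb, ?_⟩
      invFun := fun y => ⟨Function.extend emb y.1 0, ?_, ?_⟩
      left_inv := ?_
      right_inv := ?_ }
  · rw [LinearMap.mem_ker, Matrix.mulVecLin_apply]
    funext i
    rw [← key]
    simpa using x.2.2 (emb i) (by simp)
  · intro p hp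
    exact Function.extend_apply' _ _ _ fun ⟨i, hi⟩ => hp (by simp [← hi])
  · intro p hp
    obtain ⟨i, -, rfl⟩ := Finset.mem_map.1 hp
    have h0 := y.2
    rw [LinearMap.mem_ker, Matrix.mulVecLin_apply] at h0
    have h1 := key (Function.extend emb y.1 0) i
    rw [Function.extend_comp emb.injective, h0] at h1
    simpa using h1
  · rintro ⟨x, hx0, hx⟩
    refine Subtype.ext (funext fun p => ?_)
    by_cases hp : ∃ i, emb i = p
    · obtain ⟨i, rfl⟩ := hp
      exact emb.injective.extend_apply _ _ _
    · exact (Function.extend_apply' _ _ _ hp).trans (hx0 p (by simpa using hp)).symm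
  · intro y
    exact Subtype.ext (Function.extend_comp emb.injective _ _)

theorem sum_finset_map {W A : Type*} [Fintype W] [AddCommMonoid A] (emb : W ↪ ℕ)
    (g : Finset ℕ → A) : ∑ J : Finset W, g (J.map emb) = ∑ J ∈ (Finset.univ.map emb).powerset, g J :=
  Finset.sum_bij (fun J _ => J.map emb)
    (fun J _ => Finset.mem_powerset.2 (Finset.map_subset_map.2 (Finset.subset_univ J)))
    (fun _ _ _ _ h => Finset.map_injective emb h)
    (fun J hJ => by
      obtain ⟨I, -, rfl⟩ := Finset.subset_map_iff.1 (Finset.mem_powerset.1 hJ)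
      exact ⟨I, Finset.mem_univ _, rfl⟩)
    (fun _ _ => rfl)

/-- With `I = B⁻¹`, a set `J` of `m` fewer than all vertices has weight
`B ^ m * (I - 1) ^ m = (-(B - 1)) ^ m`, and `B ^ |J| * I ^ rank` is `B` to the power of the corank. -/
theorem aeval_graphSHat {L W : Type*} [CommRing L] [Fintype W] (G : SimpleGraph W) (emb : W ↪ ℕ)
    (adj : ℕ → ℕ → Prop) (hadj : ∀ u v, G.Adj u v ↔ adj (emb u) (emb v)) (A B I : L)
    (hBI : B * I = 1) :
    (A * B) ^ Fintype.card W * aeval I (graphSHat G) =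
      ∑ J ∈ (Finset.univ.map emb).powerset, ∑ M ∈ J.powerset,
        (-(A * (B - 1))) ^ (Finset.univ.map emb \ J).card * A ^ J.card * (-1) ^ M.card *
          B ^ Nat.log 2 (kernelCard adj J M) := by
  rw [← sum_finset_map, graphSHat, map_sum, Finset.mul_sum]
  refine Finset.sum_congr rfl fun J _ => ?_
  let emb' : {v | v ∈ J} ↪ ℕ := (Function.Embedding.subtype _).trans emb
  have hJ : Finset.univ.map emb' = J.map emb := by
    ext p
    simp [emb']
  have hcard : Fintype.card {v | v ∈ J} = J.card := by
    rw [← Finset.card_univ, ← Finset.card_map emb', hJ, Finset.card_map]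
  have hsub : (Finset.univ.map emb \ J.map emb).card = Fintype.card W - J.card := by
    rw [Finset.card_sdiff_of_subset (Finset.map_subset_map.2 (Finset.subset_univ J)),
      Finset.card_map, Finset.card_map, Finset.card_univ]
  have hle : J.card ≤ Fintype.card W := Finset.card_le_univ J
  rw [hsub, Finset.card_map, ← hJ, ← sum_finset_map emb', graphS, map_mul, map_sum, Finset.mul_sum,
    Finset.mul_sum]
  refine Finset.sum_congr rfl fun M _ => ?_
  rw [kernelCard_eq_two_pow (G.induce {v | v ∈ J}) M emb' adj
    (fun u v => hadj u.1 v.1), Nat.log_pow (by norm_num), hcard, Finset.card_map]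
  have hr : (markedAdj (G.induce {v | v ∈ J}) M).rank ≤ J.card := hcard ▸ Matrix.rank_le_card_width _
  obtain ⟨m, hm⟩ := Nat.exists_eq_add_of_le hle
  obtain ⟨t, ht⟩ := Nat.exists_eq_add_of_le hr
  generalize (markedAdj (G.induce {v | v ∈ J}) M).rank = r at *
  rw [hm, Nat.add_sub_cancel_left, ht, Nat.add_sub_cancel_left]
  have h1 : -(A * (B - 1)) = A * (B * (I - 1)) := by linear_combination -A * hBI
  have h2 : B ^ r * I ^ r = 1 := by rw [← mul_pow, hBI, one_pow]
  simp only [map_mul, map_pow, map_sub, map_neg, map_one, aeval_X]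
  rw [h1]
  simp only [mul_pow, pow_add]
  linear_combination (A ^ r * A ^ t * A ^ m * B ^ t * B ^ m * (I - 1) ^ m * (-1) ^ M.card) * h2

theorem theoremT {R : Type*} [CommRing R] (a b : R) :
    (∃ K : MultiDiagram → R, IsFramedKauffman a b K) ∧
    (∃ KHat : MultiDiagram → R, IsUnframedKauffman a b KHat) ∧
    ∀ K KHat : MultiDiagram → R, IsFramedKauffman a b K → IsUnframedKauffman a b KHat →
      ∀ (k : ℕ) (D : ChordDiagram), D.degree = k →
        KHat D.toMulti = ChordDiagram.deframe (fun E => K E.toMulti) D ∧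
        ∀ (L : Type*) [CommRing L] [Algebra R L] (bInv : L), algebraMap R L b * bInv = 1 →
          algebraMap R L (KHat D.toMulti) =
            algebraMap R L (a * b) ^ k *
              Polynomial.aeval bInv (graphSHat D.intersectionGraph) := by
  refine ⟨⟨_, MultiDiagram.isFramedKauffman_stateSum a b⟩,
    ⟨_, MultiDiagram.isUnframedKauffman_stateSum a b⟩, ?_⟩
  rintro K KHat hK hKHat k D rfl
  rw [hKHat.eq_stateSum _ D.isNonempty_toMulti]
  refine ⟨?_, fun L _ _ bInv hb => ?_⟩
  · rw [← ChordDiagram.deframe_stateSum]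
    congr 1
    funext E
    exact (hK.eq_stateSum _ E.isNonempty_toMulti).symm
  · have hV : Finset.univ.map (Function.Embedding.subtype (· ∈ D.chords)) = D.chords := by
      ext p
      simp
    have hcard : D.degree = Fintype.card {p // p ∈ D.chords} := (Fintype.card_coe _).symm
    rw [D.stateSum_toMulti, hcard, map_mul, aeval_graphSHat D.intersectionGraph
      (Function.Embedding.subtype (· ∈ D.chords)) D.Interlace (fun _ _ => Iff.rfl) _ _ bInv hb, hV]
    simp only [map_sum, map_mul, map_pow, map_neg, map_sub, map_one]
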